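/- Let $d\ge 1$ and let $X\subset\mathbb R^d$ be compact. For each $n\ge1$ let $\Phi_n=\{\phi_{n,j}\}_{j=1}^{N_n}$, $2\le N_n<\infty$, be a finite family of similarities $\phi_{n,j}:X\to X$, $$\phi_{n,j}(x)=r_{n,j}O_{n,j}(x+\alpha_{n,j}),\qquad r_{n,j}\in(0,1),\ O_{n,j}\ \text{orthogonal},\ \alpha_{n,j}\in\mathbb R^d .$$ Assume that: * (Moran-type iterated function system) there are constants $0<c_{1,n}\le c_{2,n}<1$ with $\lim_{n\to\infty}\prod_{i=1}^n c_{2,i}=0$ and $c_{1,n}\|x-y\|\le\|\phi_{n,j}(x)-\phi_{n,j}(y)\|\le c_{2,n}\|x-y\|$ for all $x,y\in X$, $n\ge1$, $1\le j\le N_n$; * (Moran-type open set condition) there are relatively open subsets $V_n\subseteq X$, $n\ge1$ (for example, open subsets of $\mathbb R^d$ contained in $X$), such that $\phi_{n,j}(V_{n+1})\subseteq V_n$ and $\phi_{n,i}(V_{n+1})\cap\phi_{n,j}(V_{n+1})=\emptyset$ for all $n\ge 1$ and $1\le i\ne j\le N_n$, and $\inf_{n}\mathcal L^d(V_n)>0$,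 where $\mathcal L^d$ is Lebesgue measure; * $r_0:=\inf\{r_{n,j}:1\le j\le N_n,\ n\ge1\}>0$. Let $K_1$ be the set of all limits $\lim_{k\to\infty}\phi_{1,j_1}\circ\phi_{2,j_2}\circ\cdots\circ\phi_{k,j_k}(a)$ with $1\le j_i\le N_i$ for all $i\ge1$, where $a\in X$ (the limits do not depend on $a$), and put $P_n(s)=\prod_{i=1}^n\sum_{j=1}^{N_i}r_{i,j}^{\,s}$. For every $k\ge1$ the equation $P_k(s)=1$ has a unique real solution; call it $s_k$. Then the following hold. (i) $\dim_H K_1=\liminf_{k\to\infty}s_k$. (ii) The number $s=\dim_H K_1$ is finite, and the $s$-dimensional Hausdorff measure of $K_1$ satisfies $$\begin{cases}\mathcal H^s(K_1)=+\infty,&\text{if }\liminf_{n\to\infty}P_n(s)=+\infty,\\ \mathcal H^s(K_1)=0,&\text{if }\liminf_{n\to\infty}P_n(s)=0,\\ 0<\mathcal H^s(K_1)<+\infty,&\text{if }0<\liminf_{n\to\infty}P_n(s)<+\infty.\end{cases}$$ (iii) If there are numbers $r_n$ with $r_{n,j}=r_n$ for all $n\ge1$ and $1\le j\le N_n$, then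 $\dim_H K_1=\underline{\dim}_B K_1$, where $\underline{\dim}_B A=\liminf_{\delta\to0^+}\frac{\ln N_\delta(A)}{-\ln\delta}$ is the lower box dimension and $N_\delta(A)$ is the least number of closed balls of radius $\delta$ that cover $A$. -/

import Mathlib

open Filter Topology MeasureTheory

noncomputable section

/-- Euclidean space `ℝ^d`. -/
abbrev Euc (d : ℕ) : Type := EuclideanSpace ℝ (Fin d)

/-- A Moran-type iterated function system on a compact set `X ⊆ ℝ^d` with the Euclidean metric.
Layers are numbered from `0`, so layer `n` here is layer `n + 1` in the usual numbering from `1`.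
Only the values of the maps `φ n j` on `X` matter. -/
structure MIFS (d : ℕ) where
  /-- the compact set on which all maps act -/
  X : Set (Euc d)
  isCompact_X : IsCompact X
  /-- the number of maps in each layer -/
  N : ℕ → ℕ
  two_le_N : ∀ n, 2 ≤ N n
  /-- the maps of each layer -/
  φ : (n : ℕ) → Fin (N n) → Euc d → Euc d
  mapsTo : ∀ n j, Set.MapsTo (φ n j) X X
  bilipschitz : ∃ c₁ c₂ : ℕ → ℝ,
    (∀ n, 0 < c₁ n ∧ c₁ n ≤ c₂ n ∧ c₂ n < 1) ∧
    Tendsto (fun n => ∏ i ∈ Finset.range n, c₂ i) atTop (𝓝 0) ∧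
    ∀ n j, ∀ x ∈ X, ∀ y ∈ X,
      c₁ n * dist x y ≤ dist (φ n j x) (φ n j y) ∧
      dist (φ n j x) (φ n j y) ≤ c₂ n * dist x y

namespace MIFS

variable {d : ℕ} (Φ : MIFS d)

/-- `Φ.wordMap n σ k = φ_{n,σ_n} ∘ φ_{n+1,σ_{n+1}} ∘ ⋯ ∘ φ_{n+k-1,σ_{n+k-1}}`: the map of the word
of length `k` that starts in layer `n` and is read off the infinite word `σ`. -/
def wordMap (n : ℕ) (σ : (i : ℕ) → Fin (Φ.N i)) : ℕ → Euc d → Euc d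
  | 0 => id
  | k + 1 => wordMap n σ k ∘ Φ.φ (n + k) (σ (n + k))

/-- The Moran-type invariant set of the system that starts in layer `n`: all limits of
`φ_{n,σ_n} ∘ ⋯ ∘ φ_{n+k-1,σ_{n+k-1}} (a)` as `k → ∞`, where `σ` is an infinite word and `a ∈ X`
(such a limit does not depend on `a`). -/
def attractor (n : ℕ) : Set (Euc d) :=
  {x | ∃ σ : (i : ℕ) → Fin (Φ.N i), ∃ a ∈ Φ.X,
    Tendsto (fun k => Φ.wordMap n σ k a) atTop (𝓝 x)}

/-- The Moran-type open set condition: there are relatively open sets `V n ⊆ X` (for example, open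
sets of `ℝ^d` contained in `X`), with Lebesgue measures bounded below by a positive constant,
such that the maps of layer `n` send `V (n + 1)` to pairwise disjoint subsets of `V n`. -/
def MOSC : Prop :=
  ∃ V : ℕ → Set (Euc d),
    (∀ n, ∃ U : Set (Euc d), IsOpen U ∧ V n = U ∩ Φ.X) ∧
    (∀ n j, Φ.φ n j '' V (n + 1) ⊆ V n) ∧
    (∀ n i j, i ≠ j → Φ.φ n i '' V (n + 1) ∩ Φ.φ n j '' V (n + 1) = ∅) ∧
    0 < ⨅ n, volume (V n)

/-- The maps are the similarities `φ_{n,j}(x) = r_{n,j} O_{n,j} (x + α_{n,j})`, with ratios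
`r_{n,j} ∈ (0, 1)` and orthogonal transformations `O_{n,j}`. -/
def IsSelfSimilarWith (r : (n : ℕ) → Fin (Φ.N n) → ℝ)
    (O : (n : ℕ) → Fin (Φ.N n) → (Euc d ≃ₗᵢ[ℝ] Euc d))
    (α : (n : ℕ) → Fin (Φ.N n) → Euc d) : Prop :=
  ∀ n j, 0 < r n j ∧ r n j < 1 ∧ ∀ x ∈ Φ.X, Φ.φ n j x = r n j • O n j (x + α n j)

/-- `P_k(s)`: the product over the first `k` layers of the sums `∑_j r_{i,j}^s`. -/
def ratioProd (r : (n : ℕ) → Fin (Φ.N n) → ℝ) (k : ℕ) (s : ℝ) : ℝ :=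
  ∏ i ∈ Finset.range k, ∑ j, r i j ^ s

end MIFS

/-- The lower box dimension `liminf_{δ → 0+} log N_δ(A) / (-log δ)`, where `N_δ(A)` is the least
number of closed balls of radius `δ` that cover `A`. -/
def lowerBoxDim {E : Type*} [PseudoEMetricSpace E] (A : Set E) : EReal :=
  liminf (fun δ : NNReal =>
    ENNReal.log (Metric.externalCoveringNumber δ A : ENNReal) / ((-Real.log δ : ℝ) : EReal))
    (𝓝[>] 0)

end

/-! Write r_w for the product of the ratios along a finite word w. Then P_k(s) is the sum of r_w^s
over the words of length k, and everything follows from comparing the s-dimensional Hausdorff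
measure of the invariant set, up to positive constants, with liminf P_k(s).

The upper bound, `exists_hausdorffMeasure_le`, uses the natural covers by the images of X under all
words of length k. The lower bound, `exists_le_hausdorffMeasure`, is a mass distribution argument: a
product measure gives the cylinder of w the mass r_w^s / P_k(s), and its image on the invariant set
must not charge a set of diameter ρ by more than a multiple of ρ^s. Each word is stopped when its
piece first has size at most ρ; as the ratios are bounded below, that size is still comparable to ρ.
The open set condition makes the corresponding images of the V_n disjoint, so comparing volumes
(`exists_card_le`) shows that boundedly many stopped cylinders suffice.

Since P_k is strictly decreasing, comparing P_k(q) with 1 compares q with s_k, which turns the two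
bounds into the dimension formula. With equal ratios in each layer, the natural covers consist of
pieces of one size and so bound the lower box dimension as well (`lowerBoxDim_attractor_le`). -/

noncomputable section

/-! ### Geometry of word maps, and the coding of the invariant set. -/

namespace MIFS

variable {d : ℕ} {Φ : MIFS d} {r : (n : ℕ) → Fin (Φ.N n) → ℝ}
  {O : (n : ℕ) → Fin (Φ.N n) → (Euc d ≃ₗᵢ[ℝ] Euc d)} {α : (n : ℕ) → Fin (Φ.N n) → Euc d}

/-- The product of the first `k` ratios along the infinite word `σ`. -/
def wordRatio (r : (n : ℕ) → Fin (Φ.N n) → ℝ) (σ : (i : ℕ) → Fin (Φ.N i)) (k : ℕ) : ℝ :=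
  ∏ i ∈ Finset.range k, r i (σ i)

lemma wordMap_zero_succ (σ : (i : ℕ) → Fin (Φ.N i)) (k : ℕ) :
    Φ.wordMap 0 σ (k + 1) = Φ.wordMap 0 σ k ∘ Φ.φ k (σ k) := by
  change _ ∘ Φ.φ (0 + k) (σ (0 + k)) = _
  rw [zero_add]

lemma wordMap_congr {σ τ : (i : ℕ) → Fin (Φ.N i)} {k : ℕ} (h : ∀ i < k, σ i = τ i) :
    Φ.wordMap 0 σ k = Φ.wordMap 0 τ k := by
  induction k with
  | zero => rfl
  | succ k ih =>
    rw [wordMap_zero_succ, wordMap_zero_succ, ih fun i hi => h i (by omega), h k (by omega)]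

lemma wordRatio_congr {σ τ : (i : ℕ) → Fin (Φ.N i)} {k : ℕ} (h : ∀ i < k, σ i = τ i) :
    wordRatio r σ k = wordRatio r τ k :=
  Finset.prod_congr rfl fun i hi => by rw [h i (Finset.mem_range.1 hi)]

lemma wordRatio_succ (σ : (i : ℕ) → Fin (Φ.N i)) (k : ℕ) :
    wordRatio r σ (k + 1) = wordRatio r σ k * r k (σ k) :=
  Finset.prod_range_succ _ _

lemma wordMap_mapsTo (σ : (i : ℕ) → Fin (Φ.N i)) (k : ℕ) :
    Set.MapsTo (Φ.wordMap 0 σ k) Φ.X Φ.X := by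
  induction k with
  | zero => exact Set.mapsTo_id _
  | succ k ih => rw [wordMap_zero_succ]; exact ih.comp (Φ.mapsTo _ _)

/-- Serves both for the sets of the open set condition and for the constant family `Φ.X`. -/
lemma image_wordMap_antitone (σ : (i : ℕ) → Fin (Φ.N i)) {V : ℕ → Set (Euc d)}
    (hV : ∀ n j, Φ.φ n j '' V (n + 1) ⊆ V n) :
    Antitone fun k => Φ.wordMap 0 σ k '' V k := by
  refine antitone_nat_of_succ_le fun k => ?_
  rw [wordMap_zero_succ, Set.image_comp]
  exact Set.image_mono (hV _ _)

namespace IsSelfSimilarWith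

variable (hΦ : Φ.IsSelfSimilarWith r O α)
include hΦ

lemma wordRatio_pos (σ : (i : ℕ) → Fin (Φ.N i)) (k : ℕ) : 0 < wordRatio r σ k :=
  Finset.prod_pos fun i _ => (hΦ i (σ i)).1

lemma dist_map {n : ℕ} {j : Fin (Φ.N n)} {x y : Euc d} (hx : x ∈ Φ.X) (hy : y ∈ Φ.X) :
    dist (Φ.φ n j x) (Φ.φ n j y) = r n j * dist x y := by
  rw [(hΦ n j).2.2 x hx, (hΦ n j).2.2 y hy, dist_smul₀, (O n j).dist_map, dist_add_right,
    Real.norm_of_nonneg (hΦ n j).1.le]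

lemma dist_wordMap (σ : (i : ℕ) → Fin (Φ.N i)) (k : ℕ) {x y : Euc d} (hx : x ∈ Φ.X)
    (hy : y ∈ Φ.X) :
    dist (Φ.wordMap 0 σ k x) (Φ.wordMap 0 σ k y) = wordRatio r σ k * dist x y := by
  induction k generalizing x y with
  | zero => simp [wordMap, wordRatio]
  | succ k ih =>
    rw [wordMap_zero_succ, Function.comp_apply, Function.comp_apply,
      ih (Φ.mapsTo _ _ hx) (Φ.mapsTo _ _ hy), hΦ.dist_map hx hy, wordRatio_succ, mul_assoc]

lemma injOn_wordMap (σ : (i : ℕ) → Fin (Φ.N i)) (k : ℕ) :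
    Set.InjOn (Φ.wordMap 0 σ k) Φ.X := by
  intro x hx y hy h
  have := hΦ.dist_wordMap σ k hx hy
  rw [h, dist_self, eq_comm, mul_eq_zero] at this
  exact dist_eq_zero.1 (this.resolve_left (hΦ.wordRatio_pos σ k).ne')

lemma continuousOn_wordMap (σ : (i : ℕ) → Fin (Φ.N i)) (k : ℕ) :
    ContinuousOn (Φ.wordMap 0 σ k) Φ.X := by
  refine LipschitzOnWith.continuousOn (K := (wordRatio r σ k).toNNReal)
    (LipschitzOnWith.of_dist_le_mul fun x hx y hy => ?_)
  rw [hΦ.dist_wordMap σ k hx hy, Real.coe_toNNReal _ (hΦ.wordRatio_pos σ k).le]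

open scoped Pointwise in
lemma volume_image {n : ℕ} {j : Fin (Φ.N n)} {A : Set (Euc d)} (hA : A ⊆ Φ.X) :
    volume (Φ.φ n j '' A) = ENNReal.ofReal (r n j ^ d) * volume A := by
  have h1 : Φ.φ n j '' A = r n j • ((O n j).symm ⁻¹' ((fun x => x + -α n j) ⁻¹' A)) := by
    ext y
    simp only [Set.mem_image, Set.mem_smul_set, Set.mem_preimage]
    constructor
    · rintro ⟨x, hx, rfl⟩
      exact ⟨O n j (x + α n j), by simpa using hx, ((hΦ n j).2.2 x (hA hx)).symm⟩
    · rintro ⟨z, hz, rfl⟩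
      refine ⟨_, hz, ?_⟩
      rw [(hΦ n j).2.2 _ (hA hz)]
      simp
  rw [h1, Measure.addHaar_smul, finrank_euclideanSpace_fin, abs_of_pos (pow_pos (hΦ n j).1 _)]
  congr 1
  exact ((O n j).symm.measurePreserving.measure_preimage_equiv
    (f := (O n j).symm.toMeasurableEquiv) _).trans (measure_preimage_add_right _ _ _)

lemma volume_image_wordMap (σ : (i : ℕ) → Fin (Φ.N i)) (k : ℕ) {A : Set (Euc d)}
    (hA : A ⊆ Φ.X) :
    volume (Φ.wordMap 0 σ k '' A) = ENNReal.ofReal (wordRatio r σ k ^ d) * volume A := by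
  induction k generalizing A with
  | zero => simp [wordMap, wordRatio]
  | succ k ih =>
    rw [wordMap_zero_succ, Set.image_comp,
      ih ((Set.image_mono hA).trans (Φ.mapsTo _ _).image_subset), hΦ.volume_image hA,
      wordRatio_succ, mul_pow, ENNReal.ofReal_mul (pow_pos (hΦ.wordRatio_pos σ k) _).le, mul_assoc]

/-- At the first index where the words differ, the open set condition separates the images; the
common prefix map is injective on `Φ.X`, and later letters only shrink the sets. -/
lemma disjoint_image_wordMap {V : ℕ → Set (Euc d)} (hVX : ∀ n, V n ⊆ Φ.X)
    (hV : ∀ n j, Φ.φ n j '' V (n + 1) ⊆ V n)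
    (hdisj : ∀ n i j, i ≠ j → Φ.φ n i '' V (n + 1) ∩ Φ.φ n j '' V (n + 1) = ∅)
    {σ τ : (i : ℕ) → Fin (Φ.N i)} {k l : ℕ} (h : ∃ i, i < k ∧ i < l ∧ σ i ≠ τ i) :
    Disjoint (Φ.wordMap 0 σ k '' V k) (Φ.wordMap 0 τ l '' V l) := by
  classical
  obtain ⟨hk, hl, hne⟩ := Nat.find_spec h
  have hmin : ∀ i < Nat.find h, σ i = τ i := fun i hi => by
    by_contra hne'
    exact Nat.find_min h hi ⟨hi.trans hk, hi.trans hl, hne'⟩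
  generalize Nat.find h = i at *
  refine Disjoint.mono (image_wordMap_antitone σ hV (Nat.succ_le_of_lt hk))
    (image_wordMap_antitone τ hV (Nat.succ_le_of_lt hl)) ?_
  simp only [Nat.succ_eq_add_one]
  rw [wordMap_zero_succ, wordMap_zero_succ, Set.image_comp, Set.image_comp, wordMap_congr hmin]
  exact (Set.disjoint_iff_inter_eq_empty.2 (hdisj _ _ _ hne)).image (hΦ.injOn_wordMap τ i)
    ((hV _ _).trans (hVX _)) ((hV _ _).trans (hVX _))

end IsSelfSimilarWith

lemma exists_dist_le (Φ : MIFS d) : ∃ D : ℝ, 0 < D ∧ ∀ x ∈ Φ.X, ∀ y ∈ Φ.X, dist x y ≤ D :=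
  ⟨Metric.diam Φ.X + 1, by positivity, fun x hx y hy =>
    (Metric.dist_le_diam_of_mem Φ.isCompact_X.isBounded hx hy).trans (by linarith)⟩

/-- Two disjoint nonempty images supply two points. On a one-point set the bi-Lipschitz bounds would
say nothing about the ratios. -/
lemma MOSC.nontrivial (hV : Φ.MOSC) : Φ.X.Nontrivial := by
  obtain ⟨V, hVo, hVm, hdisj, hpos⟩ := hV
  have hVX : ∀ n, V n ⊆ Φ.X := fun n => by
    obtain ⟨U, -, h⟩ := hVo n
    exact h ▸ Set.inter_subset_right
  obtain ⟨x, hx⟩ := nonempty_of_measure_ne_zero (hpos.trans_le (iInf_le _ 1)).ne'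
  have h2 := Φ.two_le_N 0
  let i : Fin (Φ.N 0) := ⟨0, by omega⟩
  let j : Fin (Φ.N 0) := ⟨1, by omega⟩
  have hij : i ≠ j := by simp [i, j]
  refine ⟨_, hVX 0 (hVm 0 i ⟨x, hx, rfl⟩), _, hVX 0 (hVm 0 j ⟨x, hx, rfl⟩), fun h => ?_⟩
  exact Set.eq_empty_iff_forall_notMem.1 (hdisj 0 i j hij) _ ⟨⟨x, hx, rfl⟩, ⟨x, hx, h.symm⟩⟩

lemma IsSelfSimilarWith.exists_wordRatio_le (hΦ : Φ.IsSelfSimilarWith r O α)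
    (hX : Φ.X.Nontrivial) :
    ∃ b : ℕ → ℝ, Tendsto b atTop (𝓝 0) ∧ ∀ σ k, wordRatio r σ k ≤ b k := by
  obtain ⟨c₁, c₂, -, hlim, hc⟩ := Φ.bilipschitz
  obtain ⟨x, hx, y, hy, hne⟩ := hX
  refine ⟨_, hlim, fun σ k => Finset.prod_le_prod (fun i _ => (hΦ i (σ i)).1.le) fun i _ => ?_⟩
  have := (hc i (σ i) x hx y hy).2
  rw [hΦ.dist_map hx hy] at this
  exact le_of_mul_le_mul_right this (dist_pos.2 hne)

/-- Every infinite word codes a point of the invariant set, which lies in all the images of `X` under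
the initial maps of the word, and every point of the invariant set arises in this way. -/
lemma IsSelfSimilarWith.exists_coding (hΦ : Φ.IsSelfSimilarWith r O α) (hX : Φ.X.Nontrivial) :
    ∃ π : ((i : ℕ) → Fin (Φ.N i)) → Euc d, Set.range π = Φ.attractor 0 ∧
      ∀ σ k, π σ ∈ Φ.wordMap 0 σ k '' Φ.X := by
  obtain ⟨D, hD, hDX⟩ := Φ.exists_dist_le
  obtain ⟨b, hb, hbr⟩ := hΦ.exists_wordRatio_le hX
  have hmem : ∀ σ, ∀ a ∈ Φ.X, ∀ k m, k ≤ m →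
      Φ.wordMap 0 σ m a ∈ Φ.wordMap 0 σ k '' Φ.X := fun σ a ha k m hkm =>
    image_wordMap_antitone σ (V := fun _ => Φ.X) (fun n j => (Φ.mapsTo n j).image_subset) hkm
      ⟨a, ha, rfl⟩
  -- Both points lie in the order-`k` piece of `σ`. This gives the Cauchy property and the
  -- independence of the base point.
  have hbound : ∀ σ, ∀ x ∈ Φ.X, ∀ y ∈ Φ.X, ∀ k m n, k ≤ m → k ≤ n →
      dist (Φ.wordMap 0 σ m x) (Φ.wordMap 0 σ n y) ≤ b k * D := by
    intro σ x hx y hy k m n hm hn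
    obtain ⟨x', hx', h1⟩ := hmem σ x hx k m hm
    obtain ⟨y', hy', h2⟩ := hmem σ y hy k n hn
    rw [← h1, ← h2, hΦ.dist_wordMap σ k hx' hy']
    exact mul_le_mul (hbr σ k) (hDX _ hx' _ hy') dist_nonneg
      ((hΦ.wordRatio_pos σ k).le.trans (hbr σ k))
  have hbD : Tendsto (fun k => b k * D) atTop (𝓝 0) := by simpa using hb.mul_const D
  obtain ⟨a, ha⟩ := hX.nonempty
  have hlim : ∀ σ, ∃ x, Tendsto (fun k => Φ.wordMap 0 σ k a) atTop (𝓝 x) := fun σ =>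
    cauchySeq_tendsto_of_complete
      (cauchySeq_of_le_tendsto_0 _ (fun m n k hm hn => hbound σ a ha a ha k m n hm hn) hbD)
  choose π hπ using hlim
  refine ⟨π, ?_, fun σ k => ?_⟩
  · ext x
    constructor
    · rintro ⟨σ, rfl⟩
      exact ⟨σ, a, ha, hπ σ⟩
    · rintro ⟨σ, a', ha', h⟩
      refine ⟨σ, ?_⟩
      have h0 : Tendsto (fun k => dist (Φ.wordMap 0 σ k a) (Φ.wordMap 0 σ k a')) atTop (𝓝 0) :=
        squeeze_zero (fun _ => dist_nonneg)
          (fun k => hbound σ a ha a' ha' k k k le_rfl le_rfl) hbD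
      exact dist_eq_zero.1 (tendsto_nhds_unique ((hπ σ).dist h) h0)
  · have hc : IsClosed (Φ.wordMap 0 σ k '' Φ.X) :=
      (Φ.isCompact_X.image_of_continuousOn (hΦ.continuousOn_wordMap σ k)).isClosed
    exact hc.mem_of_tendsto (hπ σ) ((eventually_ge_atTop k).mono fun m hm => hmem σ a ha k m hm)

end MIFS

/-! ### Natural covers and the upper bound for Hausdorff measure. -/

namespace MIFS

variable {d : ℕ} {Φ : MIFS d} {r : (n : ℕ) → Fin (Φ.N n) → ℝ}
  {O : (n : ℕ) → Fin (Φ.N n) → (Euc d ≃ₗᵢ[ℝ] Euc d)} {α : (n : ℕ) → Fin (Φ.N n) → Euc d}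

/-- An infinite word that begins with the finite word `w`. -/
def extendWord (Φ : MIFS d) {k : ℕ} (w : (i : Fin k) → Fin (Φ.N i)) (i : ℕ) : Fin (Φ.N i) :=
  if h : i < k then w ⟨i, h⟩ else ⟨0, by have := Φ.two_le_N i; omega⟩

lemma extendWord_restrict (σ : (i : ℕ) → Fin (Φ.N i)) {k i : ℕ} (hi : i < k) :
    Φ.extendWord (fun i : Fin k => σ i) i = σ i := by
  simp [extendWord, hi]

lemma wordRatio_extendWord {k : ℕ} (w : (i : Fin k) → Fin (Φ.N i)) :
    wordRatio r (Φ.extendWord w) k = ∏ i : Fin k, r i (w i) := by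
  simp [wordRatio, Finset.prod_range, extendWord]

namespace IsSelfSimilarWith

variable (hΦ : Φ.IsSelfSimilarWith r O α)
include hΦ

/-- Expanding the product of sums yields one term for each word. -/
lemma sum_wordRatio_rpow (k : ℕ) (s : ℝ) :
    ∑ w : (i : Fin k) → Fin (Φ.N i), wordRatio r (Φ.extendWord w) k ^ s =
      Φ.ratioProd r k s := by
  rw [ratioProd, Finset.prod_range, Finset.prod_univ_sum, Fintype.piFinset_univ]
  refine Finset.sum_congr rfl fun w _ => ?_
  rw [wordRatio_extendWord, ← Real.finsetProd_rpow _ _ fun i _ => (hΦ _ _).1.le]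

lemma attractor_subset (hX : Φ.X.Nontrivial) (k : ℕ) :
    Φ.attractor 0 ⊆
      ⋃ w : (i : Fin k) → Fin (Φ.N i), Φ.wordMap 0 (Φ.extendWord w) k '' Φ.X := by
  obtain ⟨π, hπ, hmem⟩ := hΦ.exists_coding hX
  rw [← hπ]
  rintro _ ⟨σ, rfl⟩
  refine Set.mem_iUnion.2 ⟨fun i => σ i, ?_⟩
  rw [wordMap_congr (τ := σ) fun i hi => extendWord_restrict σ hi]
  exact hmem σ k

lemma ediam_image_wordMap_le {D : ℝ} (hD : ∀ x ∈ Φ.X, ∀ y ∈ Φ.X, dist x y ≤ D)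
    (σ : (i : ℕ) → Fin (Φ.N i)) (k : ℕ) :
    Metric.ediam (Φ.wordMap 0 σ k '' Φ.X) ≤ ENNReal.ofReal (wordRatio r σ k * D) := by
  refine Metric.ediam_le ?_
  rintro _ ⟨x, hx, rfl⟩ _ ⟨y, hy, rfl⟩
  rw [edist_dist, hΦ.dist_wordMap σ k hx hy]
  exact ENNReal.ofReal_le_ofReal
    (mul_le_mul_of_nonneg_left (hD x hx y hy) (hΦ.wordRatio_pos σ k).le)

/-- Covering the invariant set by the images of `X` bounds its Hausdorff measure from above. -/
theorem exists_hausdorffMeasure_le (hX : Φ.X.Nontrivial) {s : ℝ} (hs : 0 ≤ s) :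
    ∃ C : ℝ, 0 < C ∧ ∀ A : ℝ, (∃ᶠ k in atTop, Φ.ratioProd r k s ≤ A) →
      μH[s] (Φ.attractor 0) ≤ ENNReal.ofReal (C * A) := by
  obtain ⟨D, hD, hDX⟩ := Φ.exists_dist_le
  obtain ⟨b, hb, hbr⟩ := hΦ.exists_wordRatio_le hX
  refine ⟨D ^ s, by positivity, fun A hA => ?_⟩
  refine (Measure.hausdorffMeasure_le_liminf_sum s (Φ.attractor 0)
    (l := atTop) (fun k : ℕ => ENNReal.ofReal (b k * D)) ?_
    (fun k (w : (i : Fin k) → Fin (Φ.N i)) => Φ.wordMap 0 (Φ.extendWord w) k '' Φ.X) ?_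
    (Eventually.of_forall fun k => hΦ.attractor_subset hX k)).trans ?_
  · simpa using ENNReal.tendsto_ofReal (hb.mul_const D)
  · exact Eventually.of_forall fun k w => (hΦ.ediam_image_wordMap_le hDX _ k).trans
      (ENNReal.ofReal_le_ofReal (mul_le_mul_of_nonneg_right (hbr _ k) hD.le))
  -- Good covers at infinitely many levels suffice, because the measure is bounded by a liminf over
  -- levels.
  · refine liminf_le_of_frequently_le' (hA.mono fun k hk => ?_)
    calc ∑ w : (i : Fin k) → Fin (Φ.N i),
          Metric.ediam (Φ.wordMap 0 (Φ.extendWord w) k '' Φ.X) ^ s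
        ≤ ∑ w : (i : Fin k) → Fin (Φ.N i),
          ENNReal.ofReal (D ^ s * wordRatio r (Φ.extendWord w) k ^ s) := by
          refine Finset.sum_le_sum fun w _ => ?_
          have hp := hΦ.wordRatio_pos (Φ.extendWord w) k
          rw [mul_comm, ← Real.mul_rpow hp.le hD.le,
            ← ENNReal.ofReal_rpow_of_nonneg (mul_pos hp hD).le hs]
          exact ENNReal.rpow_le_rpow (hΦ.ediam_image_wordMap_le hDX _ k) hs
      _ = ENNReal.ofReal (D ^ s * Φ.ratioProd r k s) := by
          rw [← ENNReal.ofReal_sum_of_nonneg fun w _ => mul_nonneg (by positivity)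
            (Real.rpow_nonneg (hΦ.wordRatio_pos _ k).le s), ← Finset.mul_sum,
            hΦ.sum_wordRatio_rpow]
      _ ≤ ENNReal.ofReal (D ^ s * A) :=
          ENNReal.ofReal_le_ofReal (mul_le_mul_of_nonneg_left hk (by positivity))

end IsSelfSimilarWith

end MIFS

/-! ### Volume counting, mass distribution and the lower bound. -/

/-- If the finite subsets of `S` whose elements are pairwise unrelated have bounded cardinality,
then such a subset of largest cardinality meets the relation with every element of `S`. -/
lemma exists_finset_pairwise_not_of_card_le {ι : Type*} {S : Set ι} {R : ι → ι → Prop}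
    (hrefl : ∀ x, R x x) (hsymm : ∀ x y, R x y → R y x) {M : ℕ}
    (hM : ∀ F : Finset ι, ↑F ⊆ S → (F : Set ι).Pairwise (fun x y => ¬ R x y) → F.card ≤ M) :
    ∃ F : Finset ι, ↑F ⊆ S ∧ F.card ≤ M ∧ ∀ y ∈ S, ∃ x ∈ F, R x y := by
  classical
  let p : ℕ → Prop := fun n =>
    ∃ F : Finset ι, ↑F ⊆ S ∧ (F : Set ι).Pairwise (fun x y => ¬ R x y) ∧ F.card = n
  have h0 : p 0 := ⟨∅, by simp, by simp, rfl⟩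
  obtain ⟨F, hFS, hF, hcard⟩ := Nat.findGreatest_spec (P := p) (Nat.zero_le M) h0
  refine ⟨F, hFS, hM F hFS hF, fun y hy => ?_⟩
  by_contra! hno
  have hyF : y ∉ F := fun h => hno y h (hrefl y)
  have hS : ↑(insert y F) ⊆ S := by
    rw [Finset.coe_insert]
    exact Set.insert_subset hy hFS
  have hpw : (↑(insert y F) : Set ι).Pairwise (fun x y => ¬ R x y) := by
    rw [Finset.coe_insert]
    exact hF.insert fun x hx _ => ⟨fun h => hno x hx (hsymm _ _ h), hno x hx⟩
  have hle := Nat.le_findGreatest (P := p) (hM _ hS hpw) ⟨_, hS, hpw, rfl⟩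
  rw [Finset.card_insert_of_notMem hyF, hcard] at hle
  omega

namespace MIFS

variable {d : ℕ} {Φ : MIFS d} {r : (n : ℕ) → Fin (Φ.N n) → ℝ}
  {O : (n : ℕ) → Fin (Φ.N n) → (Euc d ≃ₗᵢ[ℝ] Euc d)} {α : (n : ℕ) → Fin (Φ.N n) → Euc d}

lemma MOSC.exists_volume (hV : Φ.MOSC) :
    ∃ V : ℕ → Set (Euc d), (∀ n, MeasurableSet (V n)) ∧ (∀ n, V n ⊆ Φ.X) ∧
      (∀ n j, Φ.φ n j '' V (n + 1) ⊆ V n) ∧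
      (∀ n i j, i ≠ j → Φ.φ n i '' V (n + 1) ∩ Φ.φ n j '' V (n + 1) = ∅) ∧
      ∃ v : ℝ, 0 < v ∧ ∀ n, ENNReal.ofReal v ≤ volume (V n) := by
  obtain ⟨V, hVo, hVm, hdisj, hpos⟩ := hV
  have hVX : ∀ n, V n ⊆ Φ.X := fun n => by
    obtain ⟨U, -, h⟩ := hVo n
    exact h ▸ Set.inter_subset_right
  refine ⟨V, fun n => ?_, hVX, hVm, hdisj, (⨅ n, volume (V n)).toReal, ?_, fun n => ?_⟩
  · obtain ⟨U, hU, h⟩ := hVo n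
    exact h ▸ hU.measurableSet.inter Φ.isCompact_X.measurableSet
  · exact ENNReal.toReal_pos hpos.ne' ((iInf_le _ 0).trans_lt
      ((measure_mono (hVX 0)).trans_lt Φ.isCompact_X.measure_lt_top)).ne
  · exact ENNReal.ofReal_toReal_le.trans (iInf_le _ n)

lemma sum_rpow_pos (Φ : MIFS d) {r : (n : ℕ) → Fin (Φ.N n) → ℝ} (h : ∀ n j, 0 < r n j)
    (s : ℝ) (n : ℕ) : 0 < ∑ j, r n j ^ s := by
  have := Φ.two_le_N n
  exact Finset.sum_pos (fun j _ => Real.rpow_pos_of_pos (h n j) s)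
    ⟨⟨0, by omega⟩, Finset.mem_univ _⟩

namespace IsSelfSimilarWith

variable (hΦ : Φ.IsSelfSimilarWith r O α)
include hΦ

lemma ratioProd_pos (k : ℕ) (s : ℝ) : 0 < Φ.ratioProd r k s :=
  Finset.prod_pos fun i _ => Φ.sum_rpow_pos (fun n j => (hΦ n j).1) s i

/-- There is a probability measure on the infinite words that gives the cylinder of a finite word
`w` of length `k` the mass `r_w ^ s / P_k(s)`. -/
lemma exists_measure_cylinder (s : ℝ) :
    ∃ μ : Measure ((i : ℕ) → Fin (Φ.N i)), IsProbabilityMeasure μ ∧ ∀ σ k,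
      μ {τ | ∀ i < k, σ i = τ i} = ENNReal.ofReal (wordRatio r σ k ^ s / Φ.ratioProd r k s) := by
  have hpos := Φ.sum_rpow_pos (fun n j => (hΦ n j).1) s
  have hnn : ∀ n j, 0 ≤ r n j ^ s / ∑ j, r n j ^ s := fun n j =>
    div_nonneg (Real.rpow_nonneg (hΦ n j).1.le s) (hpos n).le
  have hsum : ∀ n, ∑ j, ENNReal.ofReal (r n j ^ s / ∑ j, r n j ^ s) = 1 := fun n => by
    rw [← ENNReal.ofReal_sum_of_nonneg fun j _ => hnn n j, ← Finset.sum_div,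
      div_self (hpos n).ne', ENNReal.ofReal_one]
  refine ⟨Measure.infinitePi fun n => (PMF.ofFintype _ (hsum n)).toMeasure, inferInstance,
    fun σ k => ?_⟩
  have : {τ : (i : ℕ) → Fin (Φ.N i) | ∀ i < k, σ i = τ i} =
      Set.pi (Finset.range k) fun i => {σ i} := by
    ext τ
    simp [Set.mem_pi, eq_comm]
  rw [this, Measure.infinitePi_pi _ fun i _ => measurableSet_singleton _]
  simp_rw [PMF.toMeasure_apply_singleton _ _ (measurableSet_singleton _), PMF.ofFintype_apply]
  rw [← ENNReal.ofReal_prod_of_nonneg fun i _ => hnn _ _, Finset.prod_div_distrib,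
    Real.finsetProd_rpow _ _ fun i _ => (hΦ _ _).1.le]
  rfl

/-- Words with a long common prefix code nearby points. Continuity is needed to push the measure on
words forward. -/
lemma continuous_coding (hX : Φ.X.Nontrivial) {π : ((i : ℕ) → Fin (Φ.N i)) → Euc d}
    (hπ : ∀ σ k, π σ ∈ Φ.wordMap 0 σ k '' Φ.X) : Continuous π := by
  obtain ⟨D, hD, hDX⟩ := Φ.exists_dist_le
  obtain ⟨b, hb, hbr⟩ := hΦ.exists_wordRatio_le hX
  refine continuous_iff_continuousAt.2 fun σ => Metric.tendsto_nhds.2 fun ε hε => ?_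
  have hbD : Tendsto (fun k => b k * D) atTop (𝓝 0) := by simpa using hb.mul_const D
  obtain ⟨k, hk⟩ := (hbD.eventually_lt_const hε).exists
  have hev : ∀ᶠ τ in 𝓝 σ, ∀ i ∈ Finset.range k, τ i = σ i :=
    (Finset.range k).eventually_all.2 fun i _ =>
      (continuous_apply i).continuousAt ((isOpen_discrete {σ i}).mem_nhds rfl)
  filter_upwards [hev] with τ hτ
  obtain ⟨x, hx, h1⟩ := hπ τ k
  obtain ⟨y, hy, h2⟩ := hπ σ k
  rw [← wordMap_congr (σ := τ) fun i hi => hτ i (Finset.mem_range.2 hi)] at h2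
  rw [← h1, ← h2, hΦ.dist_wordMap τ k hx hy]
  exact (mul_le_mul (hbr τ k) (hDX _ hx _ hy) dist_nonneg
    ((hΦ.wordRatio_pos τ k).le.trans (hbr τ k))).trans_lt hk

/-- Few words of comparable size, none a prefix of another, code points of a small set. -/
lemma exists_card_le (hV : Φ.MOSC) {π : ((i : ℕ) → Fin (Φ.N i)) → Euc d}
    (hπ : ∀ σ k, π σ ∈ Φ.wordMap 0 σ k '' Φ.X) {a D : ℝ} (ha : 0 < a)
    (hD : ∀ x ∈ Φ.X, ∀ y ∈ Φ.X, dist x y ≤ D) :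
    ∃ M : ℕ, ∀ (ρ : ℝ) (E : Set (Euc d)) (k : ((i : ℕ) → Fin (Φ.N i)) → ℕ)
      (F : Finset ((i : ℕ) → Fin (Φ.N i))), 0 < ρ → (∀ x ∈ E, ∀ y ∈ E, dist x y ≤ ρ) →
      ↑F ⊆ π ⁻¹' E →
      (∀ σ ∈ F, a * ρ ≤ wordRatio r σ (k σ) ∧ wordRatio r σ (k σ) * D ≤ ρ) →
      (F : Set ((i : ℕ) → Fin (Φ.N i))).Pairwise
        (fun σ τ => ∃ i, i < k σ ∧ i < k τ ∧ σ i ≠ τ i) → F.card ≤ M := by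
  obtain ⟨V, hVmeas, hVX, hVm, hdisj, v, hv, hvV⟩ := hV.exists_volume
  have hballfin : volume (Metric.ball (0 : Euc d) 1) ≠ ⊤ := measure_ball_lt_top.ne
  set β := (volume (Metric.ball (0 : Euc d) 1)).toReal with hβ
  -- The volume of a ball of radius `2 * ρ` divided by the least volume `(a * ρ) ^ d * v` of an
  -- image; `ρ` cancels.
  refine ⟨⌊2 ^ d * β / (a ^ d * v)⌋₊, fun ρ E k F hρ hE hFE hFk hFd => Nat.le_floor ?_⟩
  rcases F.eq_empty_or_nonempty with rfl | ⟨σ₀, hσ₀⟩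
  · simp only [Finset.card_empty, Nat.cast_zero]
    positivity
  have hsub : ∀ σ ∈ F, Φ.wordMap 0 σ (k σ) '' V (k σ) ⊆ Metric.closedBall (π σ₀) (2 * ρ) := by
    rintro σ hσ _ ⟨x, hx, rfl⟩
    obtain ⟨y, hy, h1⟩ := hπ σ (k σ)
    have h2 : dist (Φ.wordMap 0 σ (k σ) x) (π σ) ≤ ρ := by
      rw [← h1, hΦ.dist_wordMap σ _ (hVX _ hx) hy]
      exact (mul_le_mul_of_nonneg_left (hD _ (hVX _ hx) _ hy)
        (hΦ.wordRatio_pos σ _).le).trans (hFk σ hσ).2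
    have h3 : dist (π σ) (π σ₀) ≤ ρ := hE _ (hFE hσ) _ (hFE hσ₀)
    exact (dist_triangle _ (π σ) _).trans (by linarith)
  have hmeas : ∀ σ ∈ F, MeasurableSet (Φ.wordMap 0 σ (k σ) '' V (k σ)) := fun σ _ =>
    (hVmeas _).image_of_continuousOn_injOn ((hΦ.continuousOn_wordMap σ _).mono (hVX _))
      ((hΦ.injOn_wordMap σ _).mono (hVX _))
  have hpd : (F : Set ((i : ℕ) → Fin (Φ.N i))).PairwiseDisjoint
      fun σ => Φ.wordMap 0 σ (k σ) '' V (k σ) := fun σ hσ τ hτ hne =>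
    hΦ.disjoint_image_wordMap hVX hVm hdisj (hFd hσ hτ hne)
  have hle : (F.card : ENNReal) * ENNReal.ofReal ((a * ρ) ^ d * v) ≤
      ENNReal.ofReal ((2 * ρ) ^ d * β) := by
    calc (F.card : ENNReal) * ENNReal.ofReal ((a * ρ) ^ d * v)
        = ∑ σ ∈ F, ENNReal.ofReal ((a * ρ) ^ d * v) := by simp
      _ ≤ ∑ σ ∈ F, volume (Φ.wordMap 0 σ (k σ) '' V (k σ)) := by
          refine Finset.sum_le_sum fun σ hσ => ?_
          rw [hΦ.volume_image_wordMap σ _ (hVX _), ENNReal.ofReal_mul (by positivity)]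
          refine mul_le_mul' (ENNReal.ofReal_le_ofReal ?_) (hvV _)
          exact pow_le_pow_left₀ (by positivity) (hFk σ hσ).1 d
      _ = volume (⋃ σ ∈ F, Φ.wordMap 0 σ (k σ) '' V (k σ)) :=
          (measure_biUnion_finset hpd hmeas).symm
      _ ≤ volume (Metric.closedBall (π σ₀) (2 * ρ)) :=
          measure_mono (Set.iUnion₂_subset hsub)
      _ = ENNReal.ofReal ((2 * ρ) ^ d * β) := by
          rw [Measure.addHaar_closedBall _ _ (by positivity), finrank_euclideanSpace_fin,
            ENNReal.ofReal_mul (by positivity), hβ, ENNReal.ofReal_toReal hballfin]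
  rw [← ENNReal.ofReal_natCast, ← ENNReal.ofReal_mul (by positivity),
    ENNReal.ofReal_le_ofReal_iff (by positivity)] at hle
  rw [le_div_iff₀ (by positivity)]
  have h4 : 0 < ρ ^ d := by positivity
  rw [mul_pow, mul_pow] at hle
  exact le_of_mul_le_mul_right (by linarith) h4

/-- The mass distribution principle for the invariant set. -/
theorem exists_le_hausdorffMeasure (hV : Φ.MOSC) {r₀ : ℝ} (hr₀ : 0 < r₀)
    (hr : ∀ n j, r₀ ≤ r n j) {s : ℝ} (hs : 0 ≤ s) :
    ∃ C : ℝ, 0 < C ∧ ∀ A : ℝ, 0 < A → (∀ᶠ k in atTop, A ≤ Φ.ratioProd r k s) →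
      ENNReal.ofReal A ≤ ENNReal.ofReal C * μH[s] (Φ.attractor 0) := by
  classical
  have hX := hV.nontrivial
  obtain ⟨D, hD, hDX⟩ := Φ.exists_dist_le
  obtain ⟨b, hb, hbr⟩ := hΦ.exists_wordRatio_le hX
  obtain ⟨π, hπK, hπ⟩ := hΦ.exists_coding hX
  obtain ⟨μ, hμ, hμc⟩ := hΦ.exists_measure_cylinder s
  obtain ⟨M, hM⟩ := hΦ.exists_card_le hV hπ (a := r₀ / D) (by positivity) hDX
  have hπm : Measurable π := (hΦ.continuous_coding hX hπ).measurable
  have hr₁ : r₀ ≤ 1 := (hr 0 ⟨0, by have := Φ.two_le_N 0; omega⟩).trans (hΦ _ _).2.1.le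
  refine ⟨(M + 1) / D ^ s, by positivity, fun A hA hev => ?_⟩
  obtain ⟨k₀, hk₀⟩ := eventually_atTop.1 hev
  -- Below this scale every stopping time exceeds `k₀`, where `A` bounds the ratio products from
  -- below.
  set ε := D * r₀ ^ (k₀ + 1) with hε
  have hεpos : 0 < ε := by positivity
  have hmass : ∀ (ρ : ℝ) (E : Set (Euc d)), 0 < ρ → ρ < ε →
      (∀ x ∈ E, ∀ y ∈ E, dist x y ≤ ρ) →
      μ (π ⁻¹' E) ≤ ENNReal.ofReal ((M + 1) * ((ρ / D) ^ s / A)) := by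
    intro ρ E hρ hρε hE
    have hex : ∀ σ : (i : ℕ) → Fin (Φ.N i), ∃ k, wordRatio r σ k * D ≤ ρ := fun σ => by
      have hbD : Tendsto (fun k => b k * D) atTop (𝓝 0) := by simpa using hb.mul_const D
      obtain ⟨k, hk⟩ := (hbD.eventually_lt_const hρ).exists
      exact ⟨k, (mul_le_mul_of_nonneg_right (hbr σ k) hD.le).trans hk.le⟩
    let k : ((i : ℕ) → Fin (Φ.N i)) → ℕ := fun σ => Nat.find (hex σ)
    have hk : ∀ σ, wordRatio r σ (k σ) * D ≤ ρ := fun σ => Nat.find_spec (hex σ)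
    have hklt : ∀ σ, k₀ + 1 < k σ := fun σ => by
      by_contra! hle
      have h1 : r₀ ^ (k₀ + 1) ≤ wordRatio r σ (k σ) := by
        refine (pow_le_pow_of_le_one hr₀.le hr₁ hle).trans ?_
        have := Finset.prod_le_prod (s := Finset.range (k σ)) (f := fun _ => r₀)
          (g := fun i => r i (σ i)) (fun _ _ => hr₀.le) fun i _ => hr i (σ i)
        simpa [wordRatio] using this
      have := mul_le_mul_of_nonneg_right h1 hD.le
      linarith [hk σ, mul_comm D (r₀ ^ (k₀ + 1))]
    have hlow : ∀ σ, r₀ / D * ρ ≤ wordRatio r σ (k σ) := fun σ => by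
      obtain ⟨m, hm⟩ : ∃ m, k σ = m + 1 := ⟨k σ - 1, by have := hklt σ; omega⟩
      have h1 : ρ < wordRatio r σ m * D := not_le.1 (Nat.find_min (hex σ) (m := m) (by
        change m < k σ; omega))
      rw [hm, wordRatio_succ, div_mul_eq_mul_div, div_le_iff₀ hD]
      calc r₀ * ρ ≤ r m (σ m) * (wordRatio r σ m * D) :=
            mul_le_mul (hr _ _) h1.le hρ.le (hΦ _ _).1.le
        _ = wordRatio r σ m * r m (σ m) * D := by ring
    -- The relation says that one stopped word is a prefix of the other, so a largest unrelated
    -- family meets every word coding a point of `E`.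
    obtain ⟨F, hFE, hFM, hF⟩ := exists_finset_pairwise_not_of_card_le (S := π ⁻¹' E)
      (R := fun σ τ => ¬ ∃ i, i < k σ ∧ i < k τ ∧ σ i ≠ τ i) (M := M)
      (by simp) (by
        rintro σ τ h ⟨i, h1, h2, h3⟩
        exact h ⟨i, h2, h1, h3.symm⟩) (fun F hFE hF =>
        hM ρ E k F hρ hE hFE (fun σ _ => ⟨hlow σ, hk σ⟩)
          (hF.imp fun {σ τ} h => not_not.1 h))
    have hcover : π ⁻¹' E ⊆ ⋃ σ ∈ F, {τ | ∀ i < k σ, σ i = τ i} := by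
      intro τ hτ
      obtain ⟨σ, hσF, hστ⟩ := hF τ hτ
      push Not at hστ
      refine Set.mem_iUnion₂.2 ⟨σ, hσF, fun i hi => hστ i hi (hi.trans_le ?_)⟩
      by_contra! hlt
      -- If `τ` stopped earlier, `σ` would share that prefix and would have stopped there too.
      refine Nat.find_min (hex σ) hlt ?_
      rw [wordRatio_congr fun i hi => hστ i (hi.trans hlt) hi]
      exact hk τ
    calc μ (π ⁻¹' E) ≤ μ (⋃ σ ∈ F, {τ | ∀ i < k σ, σ i = τ i}) := measure_mono hcover
      _ ≤ ∑ σ ∈ F, μ {τ | ∀ i < k σ, σ i = τ i} := measure_biUnion_finset_le _ _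
      _ ≤ ∑ σ ∈ F, ENNReal.ofReal ((ρ / D) ^ s / A) := by
          refine Finset.sum_le_sum fun σ _ => ?_
          rw [hμc]
          refine ENNReal.ofReal_le_ofReal (div_le_div₀ (by positivity) ?_ hA
            (hk₀ _ (by have := hklt σ; omega)))
          exact Real.rpow_le_rpow (hΦ.wordRatio_pos _ _).le ((le_div_iff₀ hD).2 (hk σ)) hs
      _ = ENNReal.ofReal (F.card * ((ρ / D) ^ s / A)) := by
          rw [ENNReal.ofReal_mul (by positivity)]
          simp
      _ ≤ ENNReal.ofReal ((M + 1) * ((ρ / D) ^ s / A)) := by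
          refine ENNReal.ofReal_le_ofReal (mul_le_mul_of_nonneg_right ?_ (by positivity))
          exact_mod_cast hFM.trans (Nat.le_succ M)
  set c := A * D ^ s / (M + 1) with hc
  have hcpos : 0 < c := by positivity
  have hν : ENNReal.ofReal c • μ.map π ≤ μH[s] := by
    refine Measure.le_hausdorffMeasure s _ (ENNReal.ofReal (ε / 2)) (by simpa using hεpos) ?_
    intro E hE
    have hEfin : Metric.ediam E ≠ ⊤ := (hE.trans_lt ENNReal.ofReal_lt_top).ne
    set δ := (Metric.ediam E).toReal with hδ
    have hδε : δ < ε := by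
      have := ENNReal.toReal_le_of_le_ofReal (by positivity) hE
      linarith
    -- The diameter `δ` may be zero, so the estimate is proved for `ρ > δ` and then `ρ` decreases to
    -- `δ`. Passing to the closure makes the set measurable without changing its diameter.
    have hbd : ∀ ρ ∈ Set.Ioo δ ε, (ENNReal.ofReal c • μ.map π) E ≤ ENNReal.ofReal ρ ^ s := by
      rintro ρ ⟨h1, h2⟩
      have hρ : 0 < ρ := ENNReal.toReal_nonneg.trans_lt h1
      have hcl : ∀ x ∈ closure E, ∀ y ∈ closure E, dist x y ≤ ρ := fun x hx y hy => by
        rw [dist_edist]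
        refine (ENNReal.toReal_mono hEfin ?_).trans h1.le
        rw [← Metric.ediam_closure]
        exact Metric.edist_le_ediam_of_mem hx hy
      calc (ENNReal.ofReal c • μ.map π) E ≤ ENNReal.ofReal c * μ.map π (closure E) := by
            rw [Measure.smul_apply, smul_eq_mul]
            exact mul_le_mul_right (measure_mono subset_closure) _
        _ ≤ ENNReal.ofReal c * ENNReal.ofReal ((M + 1) * ((ρ / D) ^ s / A)) := by
            rw [Measure.map_apply hπm isClosed_closure.measurableSet]
            exact mul_le_mul_right (hmass ρ _ hρ h2 hcl) _
        _ = ENNReal.ofReal ρ ^ s := by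
            rw [← ENNReal.ofReal_mul hcpos.le, ENNReal.ofReal_rpow_of_nonneg hρ.le hs, hc,
              Real.div_rpow hρ.le hD.le]
            congr 1
            have : 0 < D ^ s := by positivity
            field_simp
    have hlim : Tendsto (fun ρ => ENNReal.ofReal ρ ^ s) (𝓝[>] δ) (𝓝 (ENNReal.ofReal δ ^ s)) :=
      ((ENNReal.continuous_rpow_const.comp ENNReal.continuous_ofReal).tendsto δ).mono_left
        nhdsWithin_le_nhds
    rw [← ENNReal.ofReal_toReal hEfin]
    exact ge_of_tendsto hlim (mem_of_superset (Ioo_mem_nhdsGT hδε) hbd)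
  have hK : ENNReal.ofReal c ≤ μH[s] (Φ.attractor 0) := by
    refine le_trans ?_ (hν _)
    rw [Measure.smul_apply, smul_eq_mul]
    refine le_mul_of_one_le_right' ?_
    -- This inequality holds for every set, so the invariant set need not be shown measurable.
    refine le_trans ?_ (Measure.le_map_apply hπm.aemeasurable _)
    rw [← hπK, Set.preimage_range, measure_univ]
  have hAc : A = (M + 1) / D ^ s * c := by
    have : 0 < D ^ s := by positivity
    rw [hc]
    field_simp
  rw [hAc, ENNReal.ofReal_mul (by positivity)]
  exact mul_le_mul_right hK _

end IsSelfSimilarWith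

end MIFS

/-! ### Hausdorff dimension against lower box dimension. -/

lemma log_div_neg_log_le_iff {δ : NNReal} (h0 : 0 < δ) (h1 : δ < 1) {N : ENNReal} {q : ℝ} :
    ENNReal.log N / ((-Real.log δ : ℝ) : EReal) ≤ q ↔ N ≤ ENNReal.ofReal ((δ : ℝ) ^ (-q)) := by
  have h0' : (0 : ℝ) < δ := h0
  have hlog : 0 < -Real.log δ := neg_pos.2 (Real.log_neg h0' h1)
  rw [EReal.div_le_iff_le_mul (by exact_mod_cast hlog) (EReal.coe_ne_top _), ← EReal.coe_mul,
    ← ENNReal.log_le_log_iff, ENNReal.log_ofReal_of_pos (by positivity), Real.log_rpow h0']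
  rw [show -Real.log δ * q = -q * Real.log δ by ring]

lemma exists_isCover_encard_eq_externalCoveringNumber {E : Type*} [PseudoEMetricSpace E]
    (δ : NNReal) (A : Set E) :
    ∃ C : Set E, Metric.IsCover δ A C ∧ C.encard = Metric.externalCoveringNumber δ A := by
  have : Nonempty {C : Set E // Metric.IsCover δ A C} := ⟨⟨A, Metric.IsCover.refl δ A⟩⟩
  obtain ⟨C, hC⟩ := ENat.exists_eq_iInf
    (fun C : {C : Set E // Metric.IsCover δ A C} => (C : Set E).encard)
  exact ⟨C, C.2, hC.trans (by rw [Metric.externalCoveringNumber, iInf_subtype'])⟩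

/-- The Hausdorff dimension of a nonempty set is at most its lower box dimension. -/
theorem dimH_le_lowerBoxDim {E : Type*} [EMetricSpace E] {A : Set E} (hA : A.Nonempty) :
    (dimH A : EReal) ≤ lowerBoxDim A := by
  borelize E
  by_contra! hlt
  obtain ⟨q, hq1, hq2⟩ := EReal.lt_iff_exists_real_btwn.1 hlt
  have hsmall : ∀ᶠ δ : NNReal in 𝓝[>] 0, 0 < δ ∧ δ < 1 := by
    filter_upwards [Ioo_mem_nhdsGT (zero_lt_one (α := NNReal))] with δ hδ using hδ
  have hq : 0 ≤ q := by
    have h0 : (0 : EReal) ≤ lowerBoxDim A := by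
      refine le_liminf_of_le (by isBoundedDefault) (hsmall.mono fun δ hδ => ?_)
      refine EReal.div_nonneg (ENNReal.zero_le_log_iff.2 ?_) ?_
      · have h1 : 1 ≤ Metric.externalCoveringNumber δ A :=
          Order.one_le_iff_ne_zero.2 (Metric.externalCoveringNumber_pos_iff.2 hA).ne'
        exact_mod_cast h1
      · exact_mod_cast (neg_pos.2 (Real.log_neg (x := δ) hδ.1 hδ.2)).le
    exact_mod_cast (h0.trans hq1.le)
  have hfreq := (frequently_lt_of_liminf_lt (by isBoundedDefault) hq1).and_eventually hsmall
  -- The radii with at most δ^(-q) covering balls. They accumulate at zero, and the sum of the q-th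
  -- powers of the diameters is at most `2 ^ q` for each of them.
  set G : Set NNReal := {δ | ∃ n : ℕ, ∃ c : Fin n → E,
    A ⊆ (⋃ i, Metric.closedEBall (c i) δ) ∧ 0 < δ ∧ (n : ℝ) ≤ (δ : ℝ) ^ (-q)} with hG
  have hGfreq : ∃ᶠ δ in 𝓝[>] 0, δ ∈ G := by
    refine hfreq.mono fun δ hδ => ?_
    have hN := (log_div_neg_log_le_iff hδ.2.1 hδ.2.2).1 hδ.1.le
    obtain ⟨C, hC, hcard⟩ := exists_isCover_encard_eq_externalCoveringNumber δ A
    rw [← hcard] at hN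
    have hfin : C.Finite := by
      rw [← Set.encard_ne_top_iff]
      intro h
      rw [h] at hN
      simp at hN
    obtain ⟨n, c, hinj, rfl⟩ := hfin.fin_param
    refine ⟨n, c, ?_, hδ.2.1, ?_⟩
    · rw [Metric.isCover_iff_subset_iUnion_closedEBall] at hC
      simpa using hC
    · rw [← Set.image_univ, hinj.encard_image, Set.encard_univ, ENat.card_eq_coe_fintype_card,
        Fintype.card_fin, ENat.toENNReal_coe, ← ENNReal.ofReal_natCast] at hN
      exact (ENNReal.ofReal_le_ofReal_iff (by positivity)).1 hN
  have hne : (𝓝[>] (0 : NNReal) ⊓ 𝓟 G).NeBot := frequently_mem_iff_neBot.1 hGfreq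
  have hpar : ∀ δ : NNReal, ∃ n : ℕ, ∃ c : Fin n → E, δ ∈ G →
      A ⊆ (⋃ i, Metric.closedEBall (c i) δ) ∧ 0 < δ ∧ (n : ℝ) ≤ (δ : ℝ) ^ (-q) := by
    intro δ
    by_cases h : δ ∈ G
    · obtain ⟨n, c, h'⟩ := h
      exact ⟨n, c, fun _ => h'⟩
    -- Dummy empty cover; the filter used below sees only radii in `G`.
    · exact ⟨0, Fin.elim0, fun h' => absurd h' h⟩
  choose n c hc using hpar
  have hmem : ∀ᶠ δ in 𝓝[>] (0 : NNReal) ⊓ 𝓟 G, δ ∈ G := mem_inf_of_right (mem_principal_self G)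
  have hdiam : ∀ δ i, Metric.ediam (Metric.closedEBall (c δ i) (δ : ENNReal)) ≤ 2 * δ :=
    fun δ i => Metric.ediam_closedEBall_le
  have hH : μH[q] A ≤ ENNReal.ofReal (2 ^ q) := by
    refine (Measure.hausdorffMeasure_le_liminf_sum q A (l := 𝓝[>] (0 : NNReal) ⊓ 𝓟 G)
      (fun δ => 2 * (δ : ENNReal)) ?_ (fun δ i => Metric.closedEBall (c δ i) δ)
      (Eventually.of_forall hdiam) (hmem.mono fun δ hδ => (hc δ hδ).1)).trans ?_
    · have : Tendsto (fun δ : NNReal => 2 * (δ : ENNReal)) (𝓝 0) (𝓝 (2 * (0 : NNReal))) :=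
        ENNReal.Tendsto.const_mul (ENNReal.continuous_coe.tendsto 0) (by simp)
      rw [ENNReal.coe_zero, mul_zero] at this
      exact this.mono_left (inf_le_left.trans nhdsWithin_le_nhds)
    · refine liminf_le_of_frequently_le' (hmem.mono fun δ hδ => ?_).frequently
      obtain ⟨-, hδ0, hn⟩ := hc δ hδ
      have hδ0' : (0 : ℝ) < δ := hδ0
      calc ∑ i, Metric.ediam (Metric.closedEBall (c δ i) (δ : ENNReal)) ^ q
          ≤ ∑ i : Fin (n δ), ENNReal.ofReal ((2 * δ) ^ q) := by
            refine Finset.sum_le_sum fun i _ => ?_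
            rw [← ENNReal.ofReal_rpow_of_nonneg (by positivity) hq,
              ENNReal.ofReal_mul (by norm_num), ENNReal.ofReal_ofNat, ENNReal.ofReal_coe_nnreal]
            exact ENNReal.rpow_le_rpow (hdiam δ i) hq
        _ = ENNReal.ofReal (n δ * (2 * δ) ^ q) := by
            rw [ENNReal.ofReal_mul (by positivity)]
            simp
        _ ≤ ENNReal.ofReal (2 ^ q) := by
            refine ENNReal.ofReal_le_ofReal ?_
            calc (n δ : ℝ) * (2 * δ) ^ q ≤ (δ : ℝ) ^ (-q) * (2 * δ) ^ q := by gcongr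
              _ = 2 ^ q := by
                rw [Real.mul_rpow (by norm_num) hδ0'.le, Real.rpow_neg hδ0'.le]
                field_simp
  lift q to NNReal using hq
  have hle := dimH_le_of_hausdorffMeasure_ne_top (hH.trans_lt ENNReal.ofReal_lt_top).ne
  rw [← EReal.coe_nnreal_eq_coe_real, EReal.coe_ennreal_lt_coe_ennreal_iff] at hq2
  exact absurd hle hq2.not_ge

/-! ### The exponents s_k and the dimension formulas. -/

namespace MIFS

variable {d : ℕ} {Φ : MIFS d} {r : (n : ℕ) → Fin (Φ.N n) → ℝ}
  {O : (n : ℕ) → Fin (Φ.N n) → (Euc d ≃ₗᵢ[ℝ] Euc d)} {α : (n : ℕ) → Fin (Φ.N n) → Euc d}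

namespace IsSelfSimilarWith

variable (hΦ : Φ.IsSelfSimilarWith r O α)
include hΦ

lemma ratioProd_strictAnti {k : ℕ} (hk : 1 ≤ k) : StrictAnti (Φ.ratioProd r k) := by
  intro s t hst
  refine Finset.prod_lt_prod_of_nonempty
    (fun i _ => Φ.sum_rpow_pos (fun n j => (hΦ n j).1) t i) (fun i _ => ?_)
    (Finset.nonempty_range_iff.2 (by omega))
  have := Φ.two_le_N i
  exact Finset.sum_lt_sum_of_nonempty ⟨⟨0, by omega⟩, Finset.mem_univ _⟩ fun j _ =>
    Real.rpow_lt_rpow_of_exponent_gt (hΦ i j).1 (hΦ i j).2.1 hst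

omit hΦ in
lemma one_lt_ratioProd_zero (r : (n : ℕ) → Fin (Φ.N n) → ℝ) {k : ℕ} (hk : 1 ≤ k) : 1 < Φ.ratioProd r k 0 := by
  have h : (2 : ℝ) ^ k ≤ Φ.ratioProd r k 0 := by
    have := Finset.prod_le_prod (s := Finset.range k) (f := fun _ => (2 : ℝ))
      (g := fun i => ∑ j, r i j ^ (0 : ℝ)) (fun _ _ => by norm_num) fun i _ => by
        simpa using Φ.two_le_N i
    simpa [ratioProd] using this
  exact (one_lt_pow₀ (by norm_num) (by omega)).trans_le h

/-- The product exceeds 1 at exponent 0 and tends to 0 at infinity; continuity gives existence and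
strict monotonicity gives uniqueness. -/
lemma existsUnique_ratioProd_eq_one {k : ℕ} (hk : 1 ≤ k) :
    ∃! s : ℝ, Φ.ratioProd r k s = 1 := by
  have hcont : Continuous (Φ.ratioProd r k) :=
    continuous_finsetProd _ fun i _ => continuous_finsetSum _ fun j _ =>
      Real.continuous_const_rpow (hΦ i j).1.ne'
  have hlim : Tendsto (Φ.ratioProd r k) atTop (𝓝 (∏ i ∈ Finset.range k, ∑ _j : Fin (Φ.N i), 0)) :=
    tendsto_finsetProd _ fun i _ => tendsto_finsetSum _ fun j _ =>
      tendsto_rpow_atTop_of_base_lt_one _ (by linarith [(hΦ i j).1]) (hΦ i j).2.1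
  have h0 : ∏ i ∈ Finset.range k, ∑ _j : Fin (Φ.N i), (0 : ℝ) = 0 :=
    Finset.prod_eq_zero (Finset.mem_range.2 (by omega : 0 < k)) (by simp)
  rw [h0] at hlim
  obtain ⟨S, hS1, hS0⟩ := ((hlim.eventually_lt_const one_pos).and (eventually_ge_atTop 0)).exists
  obtain ⟨s, -, hs⟩ := intermediate_value_Icc' hS0 hcont.continuousOn
    ⟨hS1.le, (one_lt_ratioProd_zero r hk).le⟩
  exact ⟨s, hs, fun t ht => (hΦ.ratioProd_strictAnti hk).injective (ht.trans hs.symm)⟩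

lemma pos_of_ratioProd_eq_one {k : ℕ} (hk : 1 ≤ k) {s : ℝ} (hs : Φ.ratioProd r k s = 1) :
    0 < s :=
  (hΦ.ratioProd_strictAnti hk).lt_iff_gt.1 (hs ▸ one_lt_ratioProd_zero r hk)

lemma liminf_nonneg {s : ℕ → ℝ} (hs : ∀ k, 1 ≤ k → Φ.ratioProd r k (s k) = 1) :
    (0 : EReal) ≤ liminf (fun k => (s k : EReal)) atTop :=
  le_liminf_of_le (by isBoundedDefault) <| (eventually_ge_atTop 1).mono fun k hk => by
    exact_mod_cast (hΦ.pos_of_ratioProd_eq_one hk (hs k hk)).le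

lemma frequently_ratioProd_le_one {s : ℕ → ℝ} (hs : ∀ k, 1 ≤ k → Φ.ratioProd r k (s k) = 1)
    {q : ℝ} (hq : liminf (fun k => (s k : EReal)) atTop < q) :
    ∃ᶠ k in atTop, Φ.ratioProd r k q ≤ 1 :=
  ((frequently_lt_of_liminf_lt (by isBoundedDefault) hq).and_eventually
    (eventually_ge_atTop 1)).mono fun k hk =>
      (hs k hk.2) ▸ (hΦ.ratioProd_strictAnti hk.2).antitone (by exact_mod_cast hk.1.le)

/-- For `q` above the liminf, P_k(q) ≤ 1 infinitely often and the `q`-measure is finite; for `q`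
below it, P_k(q) ≥ 1 eventually and the `q`-measure is positive. -/
theorem dimH_attractor (hV : Φ.MOSC) {r₀ : ℝ} (hr₀ : 0 < r₀) (hr : ∀ n j, r₀ ≤ r n j)
    {s : ℕ → ℝ} (hs : ∀ k, 1 ≤ k → Φ.ratioProd r k (s k) = 1) :
    (dimH (Φ.attractor 0) : EReal) = liminf (fun k => (s k : EReal)) atTop := by
  have hX := hV.nontrivial
  refine le_antisymm (le_of_not_gt fun hlt => ?_) (le_of_not_gt fun hlt => ?_)
  · obtain ⟨q, hq1, hq2⟩ := EReal.lt_iff_exists_real_btwn.1 hlt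
    have hq : 0 ≤ q := by exact_mod_cast (hΦ.liminf_nonneg hs).trans hq1.le
    obtain ⟨C, -, hC⟩ := hΦ.exists_hausdorffMeasure_le hX hq
    have hH := hC 1 (hΦ.frequently_ratioProd_le_one hs hq1)
    lift q to NNReal using hq
    have hle := dimH_le_of_hausdorffMeasure_ne_top (hH.trans_lt ENNReal.ofReal_lt_top).ne
    rw [← EReal.coe_nnreal_eq_coe_real, EReal.coe_ennreal_lt_coe_ennreal_iff] at hq2
    exact absurd hle hq2.not_ge
  · obtain ⟨q, hq1, hq2⟩ := EReal.lt_iff_exists_real_btwn.1 hlt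
    have hq : 0 ≤ q := by exact_mod_cast (EReal.coe_ennreal_nonneg _).trans hq1.le
    obtain ⟨C, -, hC⟩ := hΦ.exists_le_hausdorffMeasure hV hr₀ hr hq
    have hH := hC 1 one_pos <| ((eventually_lt_of_lt_liminf hq2).and
      (eventually_ge_atTop 1)).mono fun k hk =>
        (hs k hk.2) ▸ (hΦ.ratioProd_strictAnti hk.2).antitone (by exact_mod_cast hk.1.le)
    lift q to NNReal using hq
    have hle := le_dimH_of_hausdorffMeasure_ne_zero (s := Φ.attractor 0) (d := q) fun h0 => by
      rw [h0] at hH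
      simp at hH
    rw [← EReal.coe_nnreal_eq_coe_real, EReal.coe_ennreal_lt_coe_ennreal_iff] at hq1
    exact absurd hle hq1.not_ge

lemma externalCoveringNumber_attractor_le (hX : Φ.X.Nontrivial) {δ : NNReal} {D : ℝ}
    (hD : ∀ x ∈ Φ.X, ∀ y ∈ Φ.X, dist x y ≤ D) {k : ℕ}
    (hδ : ∀ σ, wordRatio r σ k * D ≤ δ) :
    Metric.externalCoveringNumber δ (Φ.attractor 0) ≤ (∏ i ∈ Finset.range k, Φ.N i : ℕ) := by
  obtain ⟨a, ha⟩ := hX.nonempty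
  have hcov : Metric.IsCover δ (Φ.attractor 0) (Set.range fun w : (i : Fin k) → Fin (Φ.N i) =>
      Φ.wordMap 0 (Φ.extendWord w) k a) := by
    intro x hx
    obtain ⟨w, hw⟩ := Set.mem_iUnion.1 (hΦ.attractor_subset hX k hx)
    refine ⟨_, ⟨w, rfl⟩, ?_⟩
    have hle := (Metric.edist_le_ediam_of_mem hw ⟨a, ha, rfl⟩).trans
      (hΦ.ediam_image_wordMap_le hD (Φ.extendWord w) k)
    exact hle.trans ((ENNReal.ofReal_le_ofReal (hδ _)).trans_eq (ENNReal.ofReal_coe_nnreal))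
  refine hcov.externalCoveringNumber_le_encard.trans ?_
  rw [← Set.image_univ]
  refine (Set.encard_image_le _ _).trans ?_
  rw [Set.encard_univ, ENat.card_eq_coe_fintype_card, Fintype.card_pi, Finset.prod_range]
  simp

/-- With N the number of words of length k, P_k(p) = N R_k^p. So P_k(p) ≤ 1 bounds the number of
balls of radius `R k * D` in the natural cover. -/
theorem lowerBoxDim_attractor_le (hX : Φ.X.Nontrivial) {ρ : ℕ → ℝ} (hρ : ∀ n j, r n j = ρ n)
    {s : ℕ → ℝ} (hs : ∀ k, 1 ≤ k → Φ.ratioProd r k (s k) = 1) :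
    lowerBoxDim (Φ.attractor 0) ≤ liminf (fun k => (s k : EReal)) atTop := by
  refine le_of_not_gt fun hlt => ?_
  obtain ⟨q, hq1, hq2⟩ := EReal.lt_iff_exists_real_btwn.1 hlt
  obtain ⟨p, hp1, hp2⟩ := EReal.lt_iff_exists_real_btwn.1 hq1
  have hpq : p < q := by exact_mod_cast hp2
  obtain ⟨D, hD, hDX⟩ := Φ.exists_dist_le
  obtain ⟨b, hb, hbr⟩ := hΦ.exists_wordRatio_le hX
  let σ₀ : (i : ℕ) → Fin (Φ.N i) := fun i => ⟨0, by have := Φ.two_le_N i; omega⟩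
  set R : ℕ → ℝ := fun k => ∏ i ∈ Finset.range k, ρ i with hR
  have hσR : ∀ σ k, wordRatio r σ k = R k := fun σ k => Finset.prod_congr rfl fun i _ => hρ _ _
  have hRpos : ∀ k, 0 < R k := fun k => hσR σ₀ k ▸ hΦ.wordRatio_pos σ₀ k
  have hR0 : Tendsto R atTop (𝓝 0) :=
    squeeze_zero (fun k => (hRpos k).le) (fun k => hσR σ₀ k ▸ hbr σ₀ k) hb
  have hP : ∀ k, Φ.ratioProd r k p = (∏ i ∈ Finset.range k, Φ.N i : ℕ) * R k ^ p := fun k => by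
    rw [ratioProd, hR, ← Real.finsetProd_rpow _ _ fun i _ => ?_, Nat.cast_prod,
      ← Finset.prod_mul_distrib]
    · refine Finset.prod_congr rfl fun i _ => ?_
      simp [hρ]
    · exact hρ i (σ₀ i) ▸ (hΦ i (σ₀ i)).1.le
  let δ : ℕ → NNReal := fun k => ⟨R k * D, (mul_pos (hRpos k) hD).le⟩
  have hδpos : ∀ k, 0 < δ k := fun k => mul_pos (hRpos k) hD
  have hδ0 : Tendsto δ atTop (𝓝[>] 0) := by
    refine tendsto_nhdsWithin_iff.2 ⟨?_, Eventually.of_forall hδpos⟩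
    rw [← NNReal.tendsto_coe]
    have h : Tendsto (fun k => R k * D) atTop (𝓝 (0 * D)) := hR0.mul_const D
    rw [zero_mul] at h
    exact h
  -- The gap between `p` and `q` absorbs the factor `D ^ q` caused by the size of X.
  have hsmall : ∀ᶠ k in atTop, R k ^ (q - p) * D ^ q < 1 := by
    have h1 : Tendsto (fun k => R k ^ (q - p) * D ^ q) atTop (𝓝 (0 ^ (q - p) * D ^ q)) :=
      ((hR0.rpow_const (Or.inr (by linarith))).mul_const _)
    rw [Real.zero_rpow (by linarith), zero_mul] at h1
    exact h1.eventually_lt_const one_pos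
  have hδ1 : ∀ᶠ k in atTop, δ k < 1 :=
    (hδ0.mono_right nhdsWithin_le_nhds).eventually_lt_const one_pos
  have hfreq : ∃ᶠ k in atTop,
      ENNReal.log (Metric.externalCoveringNumber (δ k) (Φ.attractor 0) : ENNReal) /
        ((-Real.log (δ k) : ℝ) : EReal) ≤ q := by
    refine ((hΦ.frequently_ratioProd_le_one hs hp1).and_eventually (hsmall.and hδ1)).mono ?_
    rintro k ⟨hk1, hk2, hk3⟩
    rw [log_div_neg_log_le_iff (hδpos k) hk3]
    have hN := hΦ.externalCoveringNumber_attractor_le hX hDX (δ := δ k) (k := k)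
      fun σ => (hσR σ k ▸ le_rfl : wordRatio r σ k * D ≤ R k * D)
    have hN' : (Metric.externalCoveringNumber (δ k) (Φ.attractor 0) : ENNReal) ≤
        ((∏ i ∈ Finset.range k, Φ.N i : ℕ) : ENNReal) :=
      (ENat.toENNReal_le.2 hN).trans_eq (ENat.toENNReal_coe _)
    refine hN'.trans ?_
    rw [← ENNReal.ofReal_natCast]
    refine ENNReal.ofReal_le_ofReal ?_
    change _ ≤ (R k * D) ^ (-q)
    rw [hP] at hk1
    rw [Real.rpow_neg (mul_pos (hRpos k) hD).le, ← one_div,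
      le_div_iff₀ (Real.rpow_pos_of_pos (mul_pos (hRpos k) hD) _), Real.mul_rpow (hRpos k).le hD.le]
    have hRq : R k ^ q = R k ^ p * R k ^ (q - p) := by
      rw [← Real.rpow_add (hRpos k)]
      congr 1
      ring
    calc ((∏ i ∈ Finset.range k, Φ.N i : ℕ) : ℝ) * (R k ^ q * D ^ q)
        = ((∏ i ∈ Finset.range k, Φ.N i : ℕ) * R k ^ p) * (R k ^ (q - p) * D ^ q) := by
          rw [hRq]
          ring
      _ ≤ 1 := mul_le_one₀ hk1 (mul_nonneg (Real.rpow_nonneg (hRpos k).le _) (by positivity)) hk2.le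
  exact absurd (liminf_le_of_frequently_le' (hδ0.frequently hfreq)) hq2.not_ge

end IsSelfSimilarWith

end MIFS

end

/-! ### Assembly of the three assertions. -/

theorem corollary4p4 (d : ℕ) (Φ : MIFS d)
    (r : (n : ℕ) → Fin (Φ.N n) → ℝ)
    (O : (n : ℕ) → Fin (Φ.N n) → (Euc d ≃ₗᵢ[ℝ] Euc d))
    (α : (n : ℕ) → Fin (Φ.N n) → Euc d)
    (hΦ : Φ.IsSelfSimilarWith r O α)
    (hV : Φ.MOSC)
    (hr : 0 < ⨅ p : (n : ℕ) × Fin (Φ.N n), r p.1 p.2) :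
    (∀ k : ℕ, 1 ≤ k → ∃! s : ℝ, Φ.ratioProd r k s = 1) ∧
    (∀ s : ℕ → ℝ, (∀ k, 1 ≤ k → Φ.ratioProd r k (s k) = 1) →
      (dimH (Φ.attractor 0) : EReal) = liminf (fun k => (s k : EReal)) atTop) ∧
    (∃ s : NNReal, dimH (Φ.attractor 0) = s ∧
      (liminf (fun n => (Φ.ratioProd r n s : EReal)) atTop = ⊤ →
        μH[s] (Φ.attractor 0) = ⊤) ∧
      (liminf (fun n => (Φ.ratioProd r n s : EReal)) atTop = 0 →
        μH[s] (Φ.attractor 0) = 0) ∧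
      (0 < liminf (fun n => (Φ.ratioProd r n s : EReal)) atTop ∧
          liminf (fun n => (Φ.ratioProd r n s : EReal)) atTop < ⊤ →
        0 < μH[s] (Φ.attractor 0) ∧ μH[s] (Φ.attractor 0) < ⊤)) ∧
    ((∃ ρ : ℕ → ℝ, ∀ n j, r n j = ρ n) →
      (dimH (Φ.attractor 0) : EReal) = lowerBoxDim (Φ.attractor 0)) := by
  have hX := hV.nontrivial
  have hr' : ∀ n j, ⨅ p : (n : ℕ) × Fin (Φ.N n), r p.1 p.2 ≤ r n j := fun n j =>
    ciInf_le (f := fun p : (n : ℕ) × Fin (Φ.N n) => r p.1 p.2)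
      ⟨0, by rintro _ ⟨p, rfl⟩; exact (hΦ p.1 p.2).1.le⟩ ⟨n, j⟩
  have hdim := fun s hs => hΦ.dimH_attractor hV hr hr' (s := s) hs
  refine ⟨fun k hk => hΦ.existsUnique_ratioProd_eq_one hk, hdim, ?_, ?_⟩
  · have hfin : dimH (Φ.attractor 0) ≠ ⊤ := by
      refine ((dimH_mono (Set.subset_univ _)).trans_lt ?_).ne
      rw [Real.dimH_univ_eq_finrank]
      exact ENNReal.natCast_lt_top _
    lift dimH (Φ.attractor 0) to NNReal using hfin with s
    obtain ⟨B, hB, hup⟩ := hΦ.exists_hausdorffMeasure_le hX s.coe_nonneg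
    obtain ⟨C, hC, hlow⟩ := hΦ.exists_le_hausdorffMeasure hV hr hr' s.coe_nonneg
    have hup' : ∀ A : ℝ, liminf (fun n => (Φ.ratioProd r n s : EReal)) atTop < A →
        μH[s] (Φ.attractor 0) ≤ ENNReal.ofReal (B * A) := fun A hA =>
      hup A ((frequently_lt_of_liminf_lt (by isBoundedDefault) hA).mono fun k hk => by
        exact_mod_cast hk.le)
    have hlow' : ∀ A : ℝ, 0 < A → A < liminf (fun n => (Φ.ratioProd r n s : EReal)) atTop →
        ENNReal.ofReal A ≤ ENNReal.ofReal C * μH[s] (Φ.attractor 0) := fun A hA hA' =>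
      hlow A hA ((eventually_lt_of_lt_liminf hA').mono fun k hk => by exact_mod_cast hk.le)
    refine ⟨s, rfl, fun h => ?_, fun h => ?_, fun h => ⟨?_, ?_⟩⟩
    · by_contra hne
      set H := (ENNReal.ofReal C * μH[s] (Φ.attractor 0)) with hH
      have hHfin : H ≠ ⊤ := ENNReal.mul_ne_top ENNReal.ofReal_ne_top hne
      -- An infinite liminf allows any `A`; one larger than the supposedly finite `H` gives a
      -- contradiction.
      have h1 := hlow' (H.toReal + 1) (by positivity) (h ▸ EReal.coe_lt_top _)
      have h2 := (ENNReal.ofReal_le_iff_le_toReal hHfin).1 h1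
      linarith
    · refine le_antisymm (ge_of_tendsto (x := 𝓝[>] (0 : ℝ))
        (f := fun A => ENNReal.ofReal (B * A)) ?_ ?_) zero_le
      · have : Tendsto (fun A => ENNReal.ofReal (B * A)) (𝓝 0) (𝓝 (ENNReal.ofReal (B * 0))) :=
          (ENNReal.continuous_ofReal.comp (continuous_const_mul B)).tendsto 0
        rw [mul_zero, ENNReal.ofReal_zero] at this
        exact this.mono_left nhdsWithin_le_nhds
      · filter_upwards [self_mem_nhdsWithin] with A hA
        exact hup' A (h ▸ by exact_mod_cast hA)
    · obtain ⟨A, hA0, hA⟩ := EReal.lt_iff_exists_real_btwn.1 h.1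
      have hA0' : 0 < A := by exact_mod_cast hA0
      refine pos_iff_ne_zero.2 fun h0 => ?_
      have := hlow' A hA0' hA
      rw [h0, mul_zero] at this
      exact (ENNReal.ofReal_pos.2 hA0').not_ge this
    · obtain ⟨A, hA, -⟩ := EReal.lt_iff_exists_real_btwn.1 h.2
      exact (hup' A hA).trans_lt ENNReal.ofReal_lt_top
  · rintro ⟨ρ, hρ⟩
    -- The value at `k = 0` is arbitrary and does not affect the liminf.
    choose! s hs using fun k (hk : 1 ≤ k) => (hΦ.existsUnique_ratioProd_eq_one hk).exists
    have hne : (Φ.attractor 0).Nonempty := by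
      obtain ⟨π, hπ, -⟩ := hΦ.exists_coding hX
      exact hπ ▸ ⟨_, ⟨fun i => ⟨0, by have := Φ.two_le_N i; omega⟩, rfl⟩⟩
    exact le_antisymm (dimH_le_lowerBoxDim hne)
      ((hΦ.lowerBoxDim_attractor_le hX hρ hs).trans_eq (hdim s hs).symm)
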